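/- Let $X$ and $Y$ be Banach spaces over the same field of scalars, $\mathbb{R}$ or $\mathbb{C}$, and let $\mathcal{L}(X,Y)$ be the set of bounded linear operators from $X$ to $Y$. Let $\Phi_-(X,Y)$ be the set of lower semi-Fredholm operators, that is, of all $T\in\mathcal{L}(X,Y)$ whose range is closed and of finite codimension in $Y$. Let $P\Phi_-(X,Y)$ be its perturbation class, that is, the set of all $K\in\mathcal{L}(X,Y)$ such that $T+K\in\Phi_-(X,Y)$ for every $T\in\Phi_-(X,Y)$. Let $\mathcal{SC}(X,Y)$ be the set of strictly cosingular operators, that is, of all $K\in\mathcal{L}(X,Y)$ such that for no closed infinite-codimensional subspace $Z$ of $Y$ is $Q_ZK$ surjective, where $Q_Z\colon Y\to Y/Z$ is the quotient operator. Suppose that $\Phi_-(X,Y)$ is not empty and that $Y$ is superprojective, that is, every closed infinite-codimensional subspace of $Y$ is contained in an infinite-codimensional subspace that is complemented in $Y$ (the range of a bounded linear projection on $Y$). Then $$P\Phi_-(X,Y)=\mathcal{SC}(X,Y).$$ -/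

import Mathlib

namespace SemiFredholm

variable {𝕜 X Y : Type*} [RCLike 𝕜]
  [NormedAddCommGroup X] [NormedSpace 𝕜 X] [NormedAddCommGroup Y] [NormedSpace 𝕜 Y]

/-- A subspace of infinite codimension: the quotient is infinite-dimensional. -/
def InfiniteCodim (M : Submodule 𝕜 X) : Prop := ¬ FiniteDimensional 𝕜 (X ⧸ M)

variable (𝕜 X Y) in
/-- `Φ₋(X, Y)`: the lower semi-Fredholm operators, i.e. the bounded operators whose range is
closed and finite-codimensional. -/
def lowerSemiFredholm : Set (X →L[𝕜] Y) :=
  {T | IsClosed (T.range : Set Y) ∧ FiniteDimensional 𝕜 (Y ⧸ T.range)}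

/-- The perturbation class of a set `𝒜` of operators from `X` to `Y`: all operators `K` such that
`T + K ∈ 𝒜` for every `T ∈ 𝒜`. -/
def perturbationClass (𝒜 : Set (X →L[𝕜] Y)) : Set (X →L[𝕜] Y) :=
  {K | ∀ T ∈ 𝒜, T + K ∈ 𝒜}

variable (𝕜 X Y) in
/-- `SC(X, Y)`: the strictly cosingular operators. For no closed infinite-codimensional subspace
`Z` of `Y` is the composition of the operator with the quotient map `Y → Y ⧸ Z` surjective. -/
def strictlyCosingular : Set (X →L[𝕜] Y) :=
  {K | ∀ Z : Submodule 𝕜 Y, IsClosed (Z : Set Y) → InfiniteCodim Z →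
    ¬ Function.Surjective (fun x : X => Z.mkQ (K x))}

variable (𝕜 X) in
/-- Every closed infinite-codimensional subspace is contained in an infinite-codimensional
complemented subspace (the range of a bounded projection). -/
def Superprojective : Prop :=
  ∀ M : Submodule 𝕜 X, IsClosed (M : Set X) → InfiniteCodim M →
    ∃ N : Submodule 𝕜 X, M ≤ N ∧ InfiniteCodim N ∧ N.ClosedComplemented

end SemiFredholm

/-!
If `T + K` is not lower semi-Fredholm, a series of small rank-one operators, each of which cuts
the range down by one more hyperplane, sums to an arbitrarily small `C` such that the range of
`T + K - C` lies in a closed infinite-codimensional subspace `W`. If `T ∈ Φ₋`, which is open, then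
`T - C` is still onto modulo a finite-dimensional `F`, and `-K` agrees with it modulo `W`; so `K`
is onto modulo `W + F` and is not strictly cosingular.

Conversely let `K` be in the perturbation class, which is stable under left composition by
operators on `Y`, and suppose `K` is onto modulo a closed infinite-codimensional subspace; by
superprojectivity that subspace can be enlarged to a complemented `N`, with projection `R` onto
`N`. Put `E = K⁻¹(N)` and take `T ∈ Φ₋`. If `T(E)` had finite codimension, then
`R T + (1 - R) K` would be in `Φ₋`, but subtracting `(1 - R) K` leaves an operator with range in
`N`. If `T(E)` has infinite codimension, some `S ∈ Φ₋` close to `T` maps `E` into an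
infinite-codimensional subspace `M` with projection `Q` onto it; `Q S - S` vanishes on `E`,
hence factors through `K` modulo `N`, so `S + (Q S - S)` would be in `Φ₋` with range in `M`.
-/

namespace SemiFredholm

open Filter Function Topology

section Algebra

variable {K V : Type*} [DivisionRing K] [AddCommGroup V] [Module K V]

theorem cofg_iff_exists_sup_eq_top {M : Submodule K V} :
    M.CoFG ↔ ∃ F : Submodule K V, FiniteDimensional K F ∧ M ⊔ F = ⊤ := by
  constructor
  · intro hM
    obtain ⟨F, hF⟩ := M.exists_isCompl
    exact ⟨F, (M.quotientEquivOfIsCompl F hF).finiteDimensional, hF.sup_eq_top⟩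
  · rintro ⟨F, hF, hMF⟩
    refine Module.Finite.of_surjective (M.mkQ.domRestrict F) (LinearMap.range_eq_top.1 ?_)
    rwa [LinearMap.range_domRestrict, Submodule.map_mkQ_eq_top]

theorem not_cofg_iInf_of_strictAnti {R M : Type*} [Ring R] [IsArtinianRing R] [AddCommGroup M]
    [Module R M] {W : ℕ → Submodule R M} (hW : StrictAnti W) :
    ¬ (⨅ n, W n).CoFG := by
  intro hfin
  let e := (⨅ n, W n).comapMkQRelIso
  have hanti : StrictAnti fun n => e.symm ⟨W n, iInf_le W n⟩ := fun m n hmn =>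
    e.symm.strictMono (hW hmn)
  exact not_strictAnti_of_wellFoundedLT _ hanti

theorem exists_retraction_of_closedComplemented {R M : Type*} [Ring R] [AddCommGroup M]
    [Module R M] [TopologicalSpace M] {N : Submodule R M} (hN : N.ClosedComplemented) :
    ∃ r : M →L[R] M, (∀ y, r y ∈ N) ∧ ∀ y ∈ N, r y = y := by
  obtain ⟨p, hp⟩ := hN
  exact ⟨N.subtypeL ∘L p, fun y => (p y).2, fun y hy => congrArg Subtype.val (hp ⟨y, hy⟩)⟩

end Algebra

section OpenMapping

theorem surjective_of_approx_preimage {X Y : Type*} [NormedAddCommGroup X] [CompleteSpace X]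
    [NormedAddCommGroup Y] (f : X →+ Y) (hf : Continuous f) {C ρ : ℝ} (hρ₀ : 0 ≤ ρ)
    (hρ₁ : ρ < 1) (h : ∀ y, ∃ x, ‖x‖ ≤ C * ‖y‖ ∧ ‖y - f x‖ ≤ ρ * ‖y‖) : Surjective f := by
  choose g hgC hgρ using h
  intro y
  let r : Y → Y := fun z => z - f (g z)
  have norm_r_le (n : ℕ) : ‖r^[n] y‖ ≤ ρ ^ n * ‖y‖ := by
    induction n with
    | zero => simp
    | succ n ih =>
      rw [iterate_succ_apply', pow_succ', mul_assoc]
      exact (hgρ _).trans (by gcongr)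
  have summable_r : Summable fun n => ‖r^[n] y‖ :=
    .of_nonneg_of_le (fun _ => norm_nonneg _) norm_r_le
      ((summable_geometric_of_lt_one hρ₀ hρ₁).mul_right _)
  have summable_g : Summable fun n => g (r^[n] y) :=
    .of_norm_bounded (summable_r.mul_left C) fun n => hgC _
  have map_sum_g (n : ℕ) : f (∑ i ∈ Finset.range n, g (r^[i] y)) = y - r^[n] y := by
    have (i : ℕ) : f (g (r^[i] y)) = r^[i] y - r^[i + 1] y := by
      rw [iterate_succ_apply', sub_sub_cancel]
    simp only [map_sum, this, Finset.sum_range_sub', iterate_zero, id_eq]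
  have tendsto_r : Tendsto (fun n => r^[n] y) atTop (𝓝 0) :=
    tendsto_zero_iff_norm_tendsto_zero.2 summable_r.tendsto_atTop_zero
  refine ⟨∑' n, g (r^[n] y), tendsto_nhds_unique
    ((hf.tendsto _).comp summable_g.hasSum.tendsto_sum_nat) ?_⟩
  simpa only [comp_def, map_sum_g, sub_zero] using tendsto_r.const_sub y

variable {𝕜 X Y : Type*} [NontriviallyNormedField 𝕜] [NormedAddCommGroup X] [NormedSpace 𝕜 X]
  [CompleteSpace X] [NormedAddCommGroup Y] [NormedSpace 𝕜 Y] [CompleteSpace Y]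

theorem isOpen_setOf_surjective : IsOpen {T : X →L[𝕜] Y | Surjective T} := by
  refine Metric.isOpen_iff.2 fun T hT => ?_
  obtain ⟨C, hC, hpre⟩ := T.exists_preimage_norm_le hT
  refine ⟨1 / (2 * C), by positivity, fun S hS => ?_⟩
  rw [mem_ball_iff_norm'] at hS
  refine surjective_of_approx_preimage (S : X →+ Y) S.continuous (C := C) one_half_pos.le
    one_half_lt_one fun y => ?_
  obtain ⟨x, rfl, hx⟩ := hpre y
  refine ⟨x, hx, ?_⟩
  calc ‖T x - S x‖ ≤ ‖T - S‖ * ‖x‖ := (T - S).le_opNorm x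
    _ ≤ 1 / (2 * C) * (C * ‖T x‖) := by gcongr
    _ = 1 / 2 * ‖T x‖ := by field_simp

theorem isClosed_range_of_isCompl {T : X →L[𝕜] Y} {G : Submodule 𝕜 Y} (hG : IsClosed (G : Set Y))
    (hTG : IsCompl T.range G) : IsClosed (T.range : Set Y) := by
  have : IsClosed (T.ker : Set X) := T.isClosed_ker
  let T' : X ⧸ T.ker →L[𝕜] Y := T.ker.liftQL T le_rfl
  have hrange : T'.range = T.range := Submodule.range_liftQ _ _ _
  have hker : T'.ker = ⊥ := Submodule.ker_liftQ_eq_bot _ _ _ le_rfl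
  rw [← hrange] at hTG ⊢
  exact T'.closed_complemented_range_of_isCompl_of_ker_eq_bot G hTG hG hker

theorem exists_comp_eq_of_ker_le {Z : Type*} [AddCommGroup Z] [Module 𝕜 Z] [TopologicalSpace Z]
    {q : X →L[𝕜] Y} (hq : Surjective q) {g : X →L[𝕜] Z} (hker : q.ker ≤ g.ker) :
    ∃ A : Y →L[𝕜] Z, A ∘L q = g := by
  have : IsClosed (q.ker : Set X) := q.isClosed_ker
  let q' : X ⧸ q.ker →L[𝕜] Y := q.ker.liftQL q le_rfl
  have hker' : q'.ker = ⊥ := Submodule.ker_liftQ_eq_bot _ _ _ le_rfl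
  have hrange' : q'.range = ⊤ :=
    (Submodule.range_liftQ _ _ _).trans (LinearMap.range_eq_top.2 hq)
  let e := ContinuousLinearEquiv.ofBijective q' hker' hrange'
  refine ⟨q.ker.liftQL g hker ∘L e.symm, ContinuousLinearMap.ext fun x => ?_⟩
  have : e.symm (q x) = q.ker.mkQ x := e.symm_apply_eq.2 rfl
  simp [this]

variable (𝕜) in
theorem exists_units_add_eq {A : Type*} [NormedRing A] [NormedAlgebra 𝕜 A] [CompleteSpace A]
    (a : A) : ∃ u v : Aˣ, (u + v : A) = a := by
  obtain ⟨k, hk⟩ := NormedField.exists_lt_norm 𝕜 (‖a‖ * ‖(1 : A)‖)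
  have hk₀ : k ≠ 0 := norm_pos_iff.1 (hk.trans_le' (by positivity))
  obtain ⟨u, hu⟩ : IsUnit (algebraMap 𝕜 A k) := (IsUnit.mk0 k hk₀).map _
  obtain ⟨v, hv⟩ : IsUnit (algebraMap 𝕜 A k - a) := spectrum.mem_resolventSet_of_norm_lt_mul hk
  exact ⟨u, -v, by rw [Units.val_neg, hu, hv]; abel⟩

end OpenMapping

variable {𝕜 X Y : Type*} [RCLike 𝕜]
  [NormedAddCommGroup X] [NormedSpace 𝕜 X] [NormedAddCommGroup Y] [NormedSpace 𝕜 Y]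

section InfiniteCodim

variable {M N : Submodule 𝕜 Y}

theorem InfiniteCodim.mono (h : M ≤ N) (hN : InfiniteCodim N) : InfiniteCodim M :=
  fun hM => hN (Submodule.CoFG.of_le h hM)

theorem InfiniteCodim.sup_finiteDimensional (hM : InfiniteCodim M) (F : Submodule 𝕜 Y)
    [FiniteDimensional 𝕜 F] : InfiniteCodim (M ⊔ F) := by
  intro hMF
  obtain ⟨G, hG, hsup⟩ := cofg_iff_exists_sup_eq_top.1 hMF
  exact hM (cofg_iff_exists_sup_eq_top.2 ⟨F ⊔ G, inferInstance, by rwa [← sup_assoc]⟩)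

end InfiniteCodim

section LowerSemiFredholm

variable {T : X →L[𝕜] Y}

theorem notMem_lowerSemiFredholm_of_range_le {N : Submodule 𝕜 Y} (hN : InfiniteCodim N)
    (h : T.range ≤ N) : T ∉ lowerSemiFredholm 𝕜 X Y :=
  fun hT => hN.mono h hT.2

variable [CompleteSpace X] [CompleteSpace Y]

theorem mem_lowerSemiFredholm_iff_cofg_range : T ∈ lowerSemiFredholm 𝕜 X Y ↔ T.range.CoFG := by
  refine ⟨And.right, fun hT => ⟨?_, hT⟩⟩
  obtain ⟨F, hTF⟩ := T.range.exists_isCompl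
  have : FiniteDimensional 𝕜 F := (T.range.quotientEquivOfIsCompl F hTF).finiteDimensional
  exact isClosed_range_of_isCompl F.closed_of_finiteDimensional hTF

theorem mem_lowerSemiFredholm_iff_exists_surjective : T ∈ lowerSemiFredholm 𝕜 X Y ↔
    ∃ F : Submodule 𝕜 Y, FiniteDimensional 𝕜 F ∧ Surjective (T.coprod F.subtypeL) := by
  have hsurj (F : Submodule 𝕜 Y) : Surjective (T.coprod F.subtypeL) ↔ T.range ⊔ F = ⊤ := by
    rw [← ContinuousLinearMap.coe_coe, ← LinearMap.range_eq_top]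
    simp [LinearMap.range_coprod]
  simp only [mem_lowerSemiFredholm_iff_cofg_range, cofg_iff_exists_sup_eq_top, hsurj]

theorem isOpen_lowerSemiFredholm : IsOpen (lowerSemiFredholm 𝕜 X Y) := by
  have eq_iUnion : lowerSemiFredholm 𝕜 X Y = ⋃ (F : Submodule 𝕜 Y) (_ : FiniteDimensional 𝕜 F),
      (fun T => T.coprod F.subtypeL) ⁻¹' {S : X × F →L[𝕜] Y | Surjective S} := by
    ext T
    simp [mem_lowerSemiFredholm_iff_exists_surjective]
  rw [eq_iUnion]
  refine isOpen_iUnion fun F => isOpen_iUnion fun hF => ?_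
  have : CompleteSpace F := FiniteDimensional.complete 𝕜 F
  refine isOpen_setOf_surjective.preimage ?_
  simp only [← ContinuousLinearMap.comp_fst_add_comp_snd]
  fun_prop

theorem equiv_comp_mem_lowerSemiFredholm (U : Y ≃L[𝕜] Y) (hT : T ∈ lowerSemiFredholm 𝕜 X Y) :
    (U : Y →L[𝕜] Y) ∘L T ∈ lowerSemiFredholm 𝕜 X Y := by
  rw [mem_lowerSemiFredholm_iff_cofg_range] at hT ⊢
  have := (Submodule.Quotient.equiv T.range _ U.toLinearEquiv rfl).finiteDimensional
  rwa [← LinearMap.range_comp] at this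

end LowerSemiFredholm

section PerturbationClass

theorem add_mem_perturbationClass {𝒜 : Set (X →L[𝕜] Y)} {K L : X →L[𝕜] Y}
    (hK : K ∈ perturbationClass 𝒜) (hL : L ∈ perturbationClass 𝒜) :
    K + L ∈ perturbationClass 𝒜 := by
  intro T hT
  rw [← add_assoc]
  exact hL _ (hK T hT)

theorem comp_mem_perturbationClass [CompleteSpace Y] {𝒜 : Set (X →L[𝕜] Y)}
    (h𝒜 : ∀ U : Y ≃L[𝕜] Y, ∀ T ∈ 𝒜, (U : Y →L[𝕜] Y) ∘L T ∈ 𝒜) {K : X →L[𝕜] Y}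
    (hK : K ∈ perturbationClass 𝒜) (B : Y →L[𝕜] Y) : B ∘L K ∈ perturbationClass 𝒜 := by
  have equiv_comp (U : Y ≃L[𝕜] Y) : (U : Y →L[𝕜] Y) ∘L K ∈ perturbationClass 𝒜 := by
    intro T hT
    have hTK := h𝒜 U _ (hK _ (h𝒜 U.symm T hT))
    rwa [ContinuousLinearMap.comp_add, ← ContinuousLinearMap.comp_assoc,
      U.coe_comp_coe_symm, ContinuousLinearMap.id_comp] at hTK
  obtain ⟨u, v, rfl⟩ := exists_units_add_eq 𝕜 B
  rw [ContinuousLinearMap.add_comp]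
  exact add_mem_perturbationClass (equiv_comp (.ofUnit u)) (equiv_comp (.ofUnit v))

end PerturbationClass

section Approximation

theorem exists_mem_norm_sub_lt (M : Submodule 𝕜 X) (x : X) {r : ℝ}
    (h : ∀ f : X →L[𝕜] 𝕜, ‖f‖ ≤ 1 → M ≤ f.ker → ‖f x‖ < r) : ∃ m ∈ M, ‖x - m‖ < r := by
  obtain ⟨φ, hφ, hφx⟩ := exists_dual_vector'' 𝕜 (M.mkQ x)
  have norm_comp_le : ‖φ ∘L M.mkQL‖ ≤ 1 :=
    ContinuousLinearMap.opNorm_le_bound _ zero_le_one fun z =>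
      φ.le_of_opNorm_le_of_le hφ (Submodule.Quotient.norm_mk_le M z)
  have le_ker : M ≤ (φ ∘L M.mkQL).ker := fun z hz => by
    simp [(Submodule.Quotient.mk_eq_zero M).2 hz]
  have norm_mk_lt : ‖M.mkQ x‖ < r := by
    calc ‖M.mkQ x‖ = ‖φ (M.mkQ x)‖ := by rw [hφx, RCLike.norm_ofReal, abs_norm]
      _ < r := h _ norm_comp_le le_ker
  obtain ⟨z, hz, hzr⟩ := Submodule.Quotient.norm_mk_lt (M.mkQ x) (sub_pos.2 norm_mk_lt)
  refine ⟨x - z, (Submodule.Quotient.eq M).1 hz.symm, ?_⟩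
  rwa [sub_sub_cancel, ← add_sub_cancel ‖M.mkQ x‖ r]

theorem surjective_of_le_norm_comp [CompleteSpace X] (S : X →L[𝕜] Y) {δ : ℝ} (hδ : 0 < δ)
    (h : ∀ f : Y →L[𝕜] 𝕜, δ * ‖f‖ ≤ ‖f ∘L S‖) : Surjective S := by
  obtain ⟨c, hc, rfl⟩ : ∃ c : ℝ, 0 < c ∧ δ = 2 * c := ⟨δ / 2, half_pos hδ, by ring⟩
  refine surjective_of_approx_preimage (S : X →+ Y) S.continuous (C := 3 / 4 / c) (ρ := 3 / 4)
    (by norm_num) (by norm_num) fun y => ?_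
  rcases eq_or_ne y 0 with rfl | hy
  · exact ⟨0, by simp⟩
  -- The graph `{(c x, S x)}` comes close to `(0, y)`: a functional `ψ` of norm at most one killing
  -- it restricts to a functional `f` on `Y` with `‖f ∘ S‖ ≤ c`, hence with `‖f‖ ≤ 1 / 2`.
  obtain ⟨_, ⟨x, rfl⟩, hx⟩ :=
    exists_mem_norm_sub_lt (((c : 𝕜) • ContinuousLinearMap.id 𝕜 X).prod S).range (0, y)
      (r := 3 / 4 * ‖y‖) fun ψ hψ hker => by
    let f : Y →L[𝕜] 𝕜 := ψ ∘L .inr 𝕜 X Y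
    have f_comp_S (x : X) : f (S x) = -((c : 𝕜) * ψ (x, 0)) := by
      have hzero : ψ ((c : 𝕜) • x, S x) = 0 := hker ⟨x, rfl⟩
      have hsplit : ((c : 𝕜) • x, S x) = (c : 𝕜) • (x, (0 : Y)) + (0, S x) := by simp
      rw [hsplit, map_add, map_smul, smul_eq_mul] at hzero
      exact eq_neg_of_add_eq_zero_right hzero
    have norm_f_comp_S_le : ‖f ∘L S‖ ≤ c := by
      refine ContinuousLinearMap.opNorm_le_bound _ hc.le fun x => ?_
      calc ‖f (S x)‖ = c * ‖ψ (x, 0)‖ := by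
            rw [f_comp_S, norm_neg, norm_mul, RCLike.norm_of_nonneg hc.le]
        _ ≤ c * ‖x‖ := by gcongr; simpa using ψ.le_of_opNorm_le hψ (x, 0)
    have norm_f_le : ‖f‖ ≤ 1 / 2 := by nlinarith [h f]
    have : 0 < ‖y‖ := norm_pos_iff.2 hy
    calc ‖f y‖ ≤ 1 / 2 * ‖y‖ := f.le_of_opNorm_le norm_f_le y
      _ < 3 / 4 * ‖y‖ := by linarith
  obtain ⟨norm_x_lt, norm_sub_lt⟩ : c * ‖x‖ < 3 / 4 * ‖y‖ ∧ ‖y - S x‖ < 3 / 4 * ‖y‖ := by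
    simpa [Prod.norm_def, norm_smul, abs_of_pos hc] using hx
  refine ⟨x, ?_, norm_sub_lt.le⟩
  rw [div_mul_eq_mul_div, le_div_iff₀' hc]
  exact norm_x_lt.le

theorem exists_norm_comp_mul_norm_le_of_not_surjective [CompleteSpace X] {S : X →L[𝕜] Y}
    (hS : ¬ Surjective S) {ε : ℝ} (hε : 0 < ε) :
    ∃ (f : Y →L[𝕜] 𝕜) (y : Y), f y = 1 ∧ ‖f ∘L S‖ * ‖y‖ ≤ ε := by
  obtain ⟨f, hf⟩ : ∃ f : Y →L[𝕜] 𝕜, ‖f ∘L S‖ < ε * ‖f‖ := by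
    by_contra! h
    exact hS (surjective_of_le_norm_comp S hε h)
  obtain ⟨y, hy, hfy⟩ := f.exists_lt_apply_of_lt_opNorm ((div_lt_iff₀' hε).2 hf)
  have hfy₀ : 0 < ‖f y‖ := hfy.trans_le' (by positivity)
  refine ⟨f, (f y)⁻¹ • y, by simp [norm_pos_iff.1 hfy₀], ?_⟩
  calc ‖f ∘L S‖ * ‖(f y)⁻¹ • y‖ = ‖f ∘L S‖ * ‖y‖ / ‖f y‖ := by
        rw [norm_smul, norm_inv]; ring
    _ ≤ ‖f ∘L S‖ * 1 / ‖f y‖ := by gcongr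
    _ ≤ ε := by
        rw [div_lt_iff₀ hε] at hfy
        rw [div_le_iff₀ hfy₀]
        linarith

theorem exists_extension_norm_mul_norm_le [CompleteSpace X] (S : X →L[𝕜] Y) {E : Submodule 𝕜 X}
    (hE : IsClosed (E : Set X)) {W : Submodule 𝕜 Y} (hEW : E.map S.toLinearMap < W) {ε : ℝ}
    (hε : 0 < ε) : ∃ (f : Y →L[𝕜] 𝕜) (g : X →L[𝕜] 𝕜), ∃ y ∈ W,
      f y = 1 ∧ (∀ x ∈ E, g x = f (S x)) ∧ ‖g‖ * ‖y‖ ≤ ε := by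
  have : CompleteSpace E := hE.completeSpace_coe
  have mem_W (x : E) : S x ∈ W := hEW.le ⟨x, x.2, rfl⟩
  let S' : E →L[𝕜] W := (S ∘L E.subtypeL).codRestrict W mem_W
  have hS' : ¬ Surjective S' := fun hsurj => hEW.not_ge fun w hw => by
    obtain ⟨x, hx⟩ := hsurj ⟨w, hw⟩
    exact ⟨x, x.2, congrArg Subtype.val hx⟩
  obtain ⟨f', y, hy, hle⟩ := exists_norm_comp_mul_norm_le_of_not_surjective hS' hε
  obtain ⟨f, hf, -⟩ := exists_extension_norm_eq W f'
  obtain ⟨g, hg, hg_norm⟩ := exists_extension_norm_eq E (f' ∘L S')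
  refine ⟨f, g, y, y.2, by rw [hf, hy], fun x hx => ?_, by rwa [hg_norm]⟩
  exact (hg ⟨x, hx⟩).trans (hf (S' ⟨x, hx⟩)).symm

/-- `EnclosedImage S E W`: the subspace `E.map S` has infinite codimension and is contained in the
closed finite-codimensional subspace `W`. This is the invariant of the iteration in
`EnclosedImage.exists_seq`, which shrinks `W` while perturbing `S`. -/
structure EnclosedImage (S : X →L[𝕜] Y) (E : Submodule 𝕜 X) (W : Submodule 𝕜 Y) : Prop where
  isClosed : IsClosed (W : Set Y)
  cofg : W.CoFG
  map_le : E.map S.toLinearMap ≤ W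
  infiniteCodim_map : InfiniteCodim (E.map S.toLinearMap)

theorem EnclosedImage.exists_lt [CompleteSpace X] {S : X →L[𝕜] Y} {E : Submodule 𝕜 X}
    {W : Submodule 𝕜 Y} (hE : IsClosed (E : Set X)) (h : EnclosedImage S E W) {ε : ℝ}
    (hε : 0 < ε) : ∃ S' W', dist S S' ≤ ε ∧ W' < W ∧ EnclosedImage S' E W' := by
  have map_lt : E.map S.toLinearMap < W :=
    h.map_le.lt_of_ne fun heq => h.infiniteCodim_map (heq ▸ h.cofg)
  obtain ⟨f, g, y, hyW, hfy, hgf, hle⟩ := exists_extension_norm_mul_norm_le S hE map_lt hε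
  let S' : X →L[𝕜] Y := S - g.smulRight y
  refine ⟨S', W ⊓ f.ker, ?_, ?_, ?_, ?_, ?_, ?_⟩
  · simpa [S', dist_eq_norm] using hle
  · refine inf_le_left.lt_of_not_ge fun hW => ?_
    have : f y = 0 := (hW hyW).2
    simp [hfy] at this
  · exact h.isClosed.inter f.isClosed_ker
  · exact h.cofg.inf (.ker _)
  · rintro _ ⟨x, hx, rfl⟩
    have hSx : S x ∈ W := h.map_le ⟨x, hx, rfl⟩
    refine ⟨W.sub_mem hSx (W.smul_mem _ hyW), ?_⟩
    simp [S', hfy, hgf x hx]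
  · refine (h.infiniteCodim_map.sup_finiteDimensional (𝕜 ∙ y)).mono ?_
    rintro _ ⟨x, hx, rfl⟩
    exact Submodule.sub_mem_sup ⟨x, hx, rfl⟩
      (Submodule.smul_mem _ _ (Submodule.mem_span_singleton_self y))

theorem EnclosedImage.exists_seq [CompleteSpace X] {S : X →L[𝕜] Y} {E : Submodule 𝕜 X}
    {W : Submodule 𝕜 Y} (hE : IsClosed (E : Set X)) (h : EnclosedImage S E W) {ε : ℕ → ℝ}
    (hε : ∀ n, 0 < ε n) :
    ∃ (T : ℕ → X →L[𝕜] Y) (V : ℕ → Submodule 𝕜 Y), T 0 = S ∧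
      (∀ n, dist (T n) (T (n + 1)) ≤ ε n) ∧ StrictAnti V ∧ ∀ n, EnclosedImage (T n) E (V n) := by
  let Pair := {p : (X →L[𝕜] Y) × Submodule 𝕜 Y // EnclosedImage p.1 E p.2}
  have step (n : ℕ) (p : Pair) : ∃ q : Pair, dist p.1.1 q.1.1 ≤ ε n ∧ q.1.2 < p.1.2 := by
    obtain ⟨S', W', hdist, hlt, h'⟩ := p.2.exists_lt hE (hε n)
    exact ⟨⟨(S', W'), h'⟩, hdist, hlt⟩
  choose next dist_next next_lt using step
  let p : ℕ → Pair := fun n => n.rec ⟨(S, W), h⟩ next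
  exact ⟨fun n => (p n).1.1, fun n => (p n).1.2, rfl, fun n => dist_next n (p n),
    strictAnti_nat_of_succ_lt fun n => next_lt n (p n), fun n => (p n).2⟩

theorem mem_closure_setOf_map_le [CompleteSpace X] [CompleteSpace Y] {S : X →L[𝕜] Y}
    {E : Submodule 𝕜 X} (hE : IsClosed (E : Set X)) (hS : InfiniteCodim (E.map S.toLinearMap)) :
    S ∈ closure {S' : X →L[𝕜] Y | ∃ W : Submodule 𝕜 Y,
      IsClosed (W : Set Y) ∧ InfiniteCodim W ∧ E.map S'.toLinearMap ≤ W} := by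
  refine Metric.mem_closure_iff.2 fun ε hε => ?_
  have h₀ : EnclosedImage S E ⊤ := ⟨isClosed_univ, inferInstance, le_top, hS⟩
  obtain ⟨T, W, rfl, dist_le, strictAnti_W, hTW⟩ :=
    h₀.exists_seq hE (ε := fun n => ε / 2 / 2 / 2 ^ n) fun n => by positivity
  obtain ⟨S', hS'⟩ := cauchySeq_tendsto_of_complete (cauchySeq_of_le_geometric_two dist_le)
  refine ⟨S', ⟨⨅ n, W n, ?_, not_cofg_iInf_of_strictAnti strictAnti_W, ?_⟩, ?_⟩
  · rw [Submodule.coe_iInf]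
    exact isClosed_iInter fun n => (hTW n).isClosed
  · rintro _ ⟨x, hx, rfl⟩
    have tendsto_apply : Tendsto (fun m => T m x) atTop (𝓝 (S' x)) :=
      ((ContinuousLinearMap.apply 𝕜 Y x).continuous.tendsto S').comp hS'
    exact (Submodule.mem_iInf _).2 fun n => (hTW n).isClosed.mem_of_tendsto tendsto_apply <|
      eventually_atTop.2 ⟨n, fun m hm => strictAnti_W.antitone hm ((hTW m).map_le ⟨x, hx, rfl⟩)⟩
  · exact (dist_le_of_le_geometric_two_of_tendsto₀ dist_le hS').trans_lt (half_lt_self hε)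

end Approximation

section Main

variable [CompleteSpace X] [CompleteSpace Y]

theorem strictlyCosingular_subset_perturbationClass :
    strictlyCosingular 𝕜 X Y ⊆ perturbationClass (lowerSemiFredholm 𝕜 X Y) := by
  intro K hK T hT
  by_contra hTK
  have infiniteCodim_range : InfiniteCodim ((⊤ : Submodule 𝕜 X).map (T + K).toLinearMap) := by
    rw [Submodule.map_top]
    exact fun h => hTK (mem_lowerSemiFredholm_iff_cofg_range.2 h)
  obtain ⟨S, hSK, W, hW_closed, hW, hSW⟩ :=
    mem_closure_iff.1 (mem_closure_setOf_map_le isClosed_univ infiniteCodim_range)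
      ((· - K) ⁻¹' lowerSemiFredholm 𝕜 X Y)
      (isOpen_lowerSemiFredholm.preimage (continuous_sub_right K)) (by simpa using hT)
  obtain ⟨F, hF, hsup⟩ := cofg_iff_exists_sup_eq_top.1 hSK.2
  refine hK (W ⊔ F) (W.isClosed_sup_finiteDimensional F hW_closed) (hW.sup_finiteDimensional F) ?_
  intro q
  obtain ⟨y, rfl⟩ := (W ⊔ F).mkQ_surjective q
  obtain ⟨_, ⟨x, rfl⟩, v, hv, rfl⟩ := Submodule.mem_sup.1 (hsup ▸ Submodule.mem_top (x := y))
  have hSx : S x ∈ W := hSW ⟨x, trivial, rfl⟩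
  have hdiff : K (-x) - ((S - K) x + v) = -(S x + v) := by
    rw [map_neg, sub_apply]
    abel
  refine ⟨-x, (Submodule.Quotient.eq _).2 ?_⟩
  rw [ContinuousLinearMap.coe_coe, hdiff]
  exact neg_mem (Submodule.add_mem_sup hSx hv)

theorem comp_mem_perturbationClass_lowerSemiFredholm {K : X →L[𝕜] Y}
    (hK : K ∈ perturbationClass (lowerSemiFredholm 𝕜 X Y)) (B : Y →L[𝕜] Y) :
    B ∘L K ∈ perturbationClass (lowerSemiFredholm 𝕜 X Y) :=
  comp_mem_perturbationClass (fun U _ => equiv_comp_mem_lowerSemiFredholm U) hK B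

theorem comp_add_sub_mem_lowerSemiFredholm {N : Submodule 𝕜 Y} {R : Y →L[𝕜] Y}
    (hRN : ∀ y ∈ N, R y = y) {K T : X →L[𝕜] Y} (hK : Surjective fun x => N.mkQ (K x))
    (hT : ((N.comap K.toLinearMap).map T.toLinearMap).CoFG) :
    R ∘L T + (K - R ∘L K) ∈ lowerSemiFredholm 𝕜 X Y := by
  obtain ⟨F, hF, hsup⟩ := cofg_iff_exists_sup_eq_top.1 hT
  refine mem_lowerSemiFredholm_iff_cofg_range.2 <| cofg_iff_exists_sup_eq_top.2
    ⟨F.map R.toLinearMap, inferInstance, eq_top_iff.2 fun y _ => ?_⟩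
  obtain ⟨x₁, hx₁⟩ := hK (N.mkQ y)
  have apply_K_x₁ : K x₁ - R (K x₁) = y - R y := by
    rw [sub_eq_sub_iff_sub_eq_sub, ← map_sub, hRN _ ((Submodule.Quotient.eq N).1 hx₁)]
  obtain ⟨_, ⟨x₂, hx₂, rfl⟩, v, hv, hsum⟩ :=
    Submodule.mem_sup.1 (hsup ▸ Submodule.mem_top (x := y - T x₁))
  have apply_K_x₂ : R (K x₂) = K x₂ := hRN _ hx₂
  refine Submodule.mem_sup.2 ⟨_, ⟨x₁ + x₂, rfl⟩, R v, ⟨v, hv, rfl⟩, ?_⟩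
  have apply_sum : R (T x₂) + R v = R y - R (T x₁) := by
    rw [← map_add, ← map_sub, ← hsum, ContinuousLinearMap.coe_coe]
  calc R (T (x₁ + x₂)) + (K (x₁ + x₂) - R (K (x₁ + x₂))) + R v
      = R (T x₁) + (R (T x₂) + R v) + (K x₁ - R (K x₁)) := by
        simp only [map_add, apply_K_x₂]
        abel
    _ = y := by rw [apply_sum, apply_K_x₁, add_sub_cancel, add_sub_cancel]

theorem infiniteCodim_map_comap_of_closedComplemented {K : X →L[𝕜] Y}
    (hK : K ∈ perturbationClass (lowerSemiFredholm 𝕜 X Y)) {N : Submodule 𝕜 Y}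
    (hN_compl : N.ClosedComplemented) (hN : InfiniteCodim N)
    (hsurj : Surjective fun x => N.mkQ (K x)) (T : X →L[𝕜] Y) :
    InfiniteCodim ((N.comap K.toLinearMap).map T.toLinearMap) := by
  obtain ⟨R, hR_mem, hR_eq⟩ := exists_retraction_of_closedComplemented hN_compl
  intro hcofg
  have hmem := comp_mem_perturbationClass_lowerSemiFredholm hK (R - .id 𝕜 Y) _
    (comp_add_sub_mem_lowerSemiFredholm hR_eq hsurj hcofg)
  rw [ContinuousLinearMap.sub_comp, ContinuousLinearMap.id_comp, add_assoc,
    sub_add_sub_cancel, sub_self, add_zero] at hmem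
  refine notMem_lowerSemiFredholm_of_range_le hN ?_ hmem
  rintro _ ⟨x, rfl⟩
  exact hR_mem (T x)

theorem cofg_map_comap_of_superprojective (hY : Superprojective 𝕜 Y) {K : X →L[𝕜] Y}
    (hK : K ∈ perturbationClass (lowerSemiFredholm 𝕜 X Y)) {N : Submodule 𝕜 Y}
    (hN : IsClosed (N : Set Y)) (hsurj : Surjective fun x => N.mkQ (K x))
    {T : X →L[𝕜] Y} (hT : T ∈ lowerSemiFredholm 𝕜 X Y) :
    ((N.comap K.toLinearMap).map T.toLinearMap).CoFG := by
  by_contra hinf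
  obtain ⟨S, hS, W, hW_closed, hW, hSW⟩ :=
    mem_closure_iff.1 (mem_closure_setOf_map_le (hN.preimage K.continuous) hinf)
      _ isOpen_lowerSemiFredholm hT
  obtain ⟨M, hWM, hM, hM_compl⟩ := hY W hW_closed hW
  obtain ⟨R, hR_mem, hR_eq⟩ := exists_retraction_of_closedComplemented hM_compl
  have ker_le : (N.mkQL ∘L K).ker ≤ (R ∘L S - S).ker := by
    intro x hx
    have hKx : K x ∈ N := (Submodule.Quotient.mk_eq_zero N).1 hx
    exact sub_eq_zero.2 (hR_eq _ (hWM (hSW ⟨x, hKx, rfl⟩)))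
  obtain ⟨A, hA⟩ := exists_comp_eq_of_ker_le (q := N.mkQL ∘L K) hsurj ker_le
  have hmem := comp_mem_perturbationClass_lowerSemiFredholm hK (A ∘L N.mkQL) S hS
  rw [ContinuousLinearMap.comp_assoc, hA, add_sub_cancel] at hmem
  refine notMem_lowerSemiFredholm_of_range_le hM ?_ hmem
  rintro _ ⟨x, rfl⟩
  exact hR_mem (S x)

theorem perturbationClass_subset_strictlyCosingular
    (hne : (lowerSemiFredholm 𝕜 X Y).Nonempty) (hY : Superprojective 𝕜 Y) :
    perturbationClass (lowerSemiFredholm 𝕜 X Y) ⊆ strictlyCosingular 𝕜 X Y := by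
  intro K hK Z hZ_closed hZ hsurj
  obtain ⟨T, hT⟩ := hne
  obtain ⟨N, hZN, hN, hN_compl⟩ := hY Z hZ_closed hZ
  have hsurj' : Surjective fun x => N.mkQ (K x) :=
    (Submodule.factor_surjective hZN).comp hsurj
  have cofg_map : ((N.comap K.toLinearMap).map T.toLinearMap).CoFG :=
    cofg_map_comap_of_superprojective hY hK hN_compl.isClosed hsurj' hT
  exact infiniteCodim_map_comap_of_closedComplemented hK hN_compl hN hsurj' T cofg_map

end Main

end SemiFredholm

theorem theorem4 {𝕜 X Y : Type*} [RCLike 𝕜]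
    [NormedAddCommGroup X] [NormedSpace 𝕜 X] [CompleteSpace X]
    [NormedAddCommGroup Y] [NormedSpace 𝕜 Y] [CompleteSpace Y]
    (hne : (SemiFredholm.lowerSemiFredholm 𝕜 X Y).Nonempty)
    (hY : SemiFredholm.Superprojective 𝕜 Y) :
    SemiFredholm.perturbationClass (SemiFredholm.lowerSemiFredholm 𝕜 X Y) =
      SemiFredholm.strictlyCosingular 𝕜 X Y :=
  (SemiFredholm.perturbationClass_subset_strictlyCosingular hne hY).antisymm
    SemiFredholm.strictlyCosingular_subset_perturbationClass
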